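/- Let $N,K\ge 1$ be integers. Consider a server with $N$ files $W_1,\dots,W_N$, independent and uniform on $[2^F]$ (where $F\ge1$ is an integer and $[a]=\{1,\dots,a\}$), and $K$ users. For $M\ge0$ and $\mathbf R=(R_{\mathbf d})_{\mathbf d\in[N]^K}$ with all $R_{\mathbf d}\ge 0$, an $(M,\mathbf R)$ caching scheme of file size $F$ consists of a cache encoder assigning indices $z_k(w)\in[2^{\lfloor FM\rfloor}]$, $k\in[K]$, to each $w\in[2^F]^N$; an update encoder assigning an index $x_{\mathbf d}(w)\in[2^{\lfloor FR_{\mathbf d}\rfloor}]$ to each $(w,\mathbf d)\in[2^F]^N\times[N]^K$; and $K$ decoders, decoder $k$ mapping $(z_k,x_{\mathbf d},\mathbf d)$ to an estimate $\hat w_{d_k}\in[2^F]$. Its probability of error is $\max_{\mathbf d\in[N]^K}\max_{k\in[K]}\mathbb P(\hat W_{d_k}\ne W_{d_k})$. The tuple $(M,\mathbf R)$ is achievable if for every $\epsilon>0$ there is an $(M,\mathbf R)$ caching scheme of some file size $F\geq 1$ with probability of error less than $\epsilon$, and $\mathcal R^\star$ is the closure of the set of achievable tuples. For $M\ge 0$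 put $$R^\star_{\mathsf{uniform}}(M)=\min_{\mathbf R:(M,\mathbf R)\in\mathcal R^\star}\ \sum_{\mathbf d\in[N]^K}N^{-K}R_{\mathbf d},\qquad R^\star_{\mathsf{worst}}(M)=\min_{\mathbf R:(M,\mathbf R)\in\mathcal R^\star}\ \max_{\mathbf d\in[N]^K}R_{\mathbf d}$$ (the first is the optimal average rate when the $K$ requests are i.i.d. and uniform on $[N]$). Then for all $M\ge0$ both minima exist, and, with $x^+=\max\{x,0\}$, $$R^\star_{\mathsf{uniform}}(M)\ \ge\ \max_{k\in[K]}\left(1-\left(1-\tfrac1N\right)^k\right)(N-kM)^+ ,$$ and the same lower bound holds for $R^\star_{\mathsf{worst}}(M)$. -/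

import Mathlib

namespace CodedCaching

/-- A database content: `N` files of `F` bits each, every file being an element of `[2 ^ F]`. -/
abbrev Database (N F : ℕ) : Type := Fin N → Fin (2 ^ F)

/-- A request vector: user `k` requests the file `d k`. -/
abbrev Request (N K : ℕ) : Type := Fin K → Fin N

/-- An `(M, R)` caching scheme with file size `F`, for `N` files and `K` users.
It is used only for nonnegative `M` and `R`. -/
structure Scheme (N K F : ℕ) (M : ℝ) (R : Request N K → ℝ) where
  /-- cache encoder: the index `z_k(w)` placed in the cache of user `k` -/
  cache : Database N F → (k : Fin K) → Fin (2 ^ ⌊(F : ℝ) * M⌋₊)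
  /-- update encoder: the index `x_d(w)` broadcast to all users -/
  update : Database N F → (d : Request N K) → Fin (2 ^ ⌊(F : ℝ) * R d⌋₊)
  /-- decoders: decoder `k` maps `(z_k, d, x_d)` to an estimate of the file `w_{d_k}` -/
  decode : (k : Fin K) → Fin (2 ^ ⌊(F : ℝ) * M⌋₊) → (d : Request N K) →
    Fin (2 ^ ⌊(F : ℝ) * R d⌋₊) → Fin (2 ^ F)

namespace Scheme

variable {N K F : ℕ} {M : ℝ} {R : Request N K → ℝ}

/-- The estimate of user `k` when the database is `w` and the request vector is `d`. -/
def estimate (S : Scheme N K F M R) (w : Database N F) (d : Request N K) (k : Fin K) :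
    Fin (2 ^ F) :=
  S.decode k (S.cache w k) d (S.update w d)

/-- The probability that user `k` decodes wrongly under the request vector `d`. The files are
independent and uniform on `[2 ^ F]`, that is, the database is uniform on the finite set
`Database N F`, so this is the number of bad databases over the number of databases. -/
noncomputable def userError (S : Scheme N K F M R) (d : Request N K) (k : Fin K) : ℝ :=
  ((Finset.univ.filter fun w : Database N F => S.estimate w d k ≠ w (d k)).card : ℝ) /
    (Fintype.card (Database N F) : ℝ)

/-- The probability of error of a scheme: the maximum over requests and users. -/
noncomputable def errorProb (S : Scheme N K F M R) : ℝ :=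
  ⨆ d : Request N K, ⨆ k : Fin K, S.userError d k

end Scheme

/-- The set of achievable (nonnegative) rate tuples `(M, R)`. -/
def achievable (N K : ℕ) : Set (ℝ × (Request N K → ℝ)) :=
  {p | 0 ≤ p.1 ∧ (∀ d, 0 ≤ p.2 d) ∧
    ∀ ε : ℝ, 0 < ε → ∃ F : ℕ, 0 < F ∧ ∃ S : Scheme N K F p.1 p.2, S.errorProb < ε}

/-- The optimal rate region. -/
def optimalRegion (N K : ℕ) : Set (ℝ × (Request N K → ℝ)) :=
  closure (achievable N K)

/-- The worst-case update rates that are compatible with memory `M`. -/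
def worstRates (N K : ℕ) (M : ℝ) : Set ℝ :=
  {r | ∃ R : Request N K → ℝ, (M, R) ∈ optimalRegion N K ∧ r = ⨆ d, R d}

/-- The average update rates, for the request distribution `p`, that are compatible with
memory `M`. -/
def avgRates (N K : ℕ) (p : Request N K → ℝ) (M : ℝ) : Set ℝ :=
  {r | ∃ R : Request N K → ℝ, (M, R) ∈ optimalRegion N K ∧ r = ∑ d, p d * R d}

/-- The distribution of i.i.d. requests with marginal `q`. -/
noncomputable def iidRequests {N K : ℕ} (q : Fin N → ℝ) : Request N K → ℝ :=
  fun d => ∏ k, q (d k)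

/-- The distribution of i.i.d. requests that are uniform on the `N` files. -/
noncomputable def uniformRequests (N K : ℕ) : Request N K → ℝ :=
  iidRequests fun _ => 1 / (N : ℝ)

/-- The optimal worst-case rate. -/
noncomputable def worstRate (N K : ℕ) (M : ℝ) : ℝ := sInf (worstRates N K M)

/-- The optimal average rate for the request distribution `p`. -/
noncomputable def avgRate (N K : ℕ) (p : Request N K → ℝ) (M : ℝ) : ℝ := sInf (avgRates N K p M)

/-- The optimal average rate for uniform i.i.d. requests. -/
noncomputable def uniformRate (N K : ℕ) (M : ℝ) : ℝ := avgRate N K (uniformRequests N K) M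

/-- The converse bound: the maximum over `k ∈ [K]` of `(1 - (1 - 1/N)^k) (N - k M)^+`. -/
noncomputable def converseBound (N K : ℕ) (hK : 1 ≤ K) (M : ℝ) : ℝ :=
  (Finset.Icc 1 K).sup' (Finset.nonempty_Icc.mpr hK) fun k : ℕ =>
    (1 - (1 - 1 / (N : ℝ)) ^ k) * max ((N : ℝ) - (k : ℝ) * M) 0

end CodedCaching

/-!
The bound is a counting argument. Fix a set `U` of `k` users and call a database good if every user
decodes correctly under every request vector `d`; a union bound shows that all but a small fraction
of the `2 ^ (N F)` databases are good (`Scheme.card_goodDatabases_ge`). Split the good databases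
according to the contents of the `k` caches, which gives at most `2 ^ (k F M)` classes. Within one
class, the update for `d` determines the files requested by `U`, so the projection of the class to
these coordinates has at most `2 ^ (F R_d)` elements. The combinatorial form of Shearer's inequality
(`Finset.card_le_prod_card_image_restrict`) bounds the size of a class by the weighted geometric
mean of these projections, for any weights `c` under which every file is covered with total weight
`1`. Together, `N ≤ k M + ∑ d, c d * R d`, up to a term that vanishes with the error probability
(`le_of_mem_achievable`); being a closed condition, this passes to the closure of the achievable set.

Under uniform requests, a given file is requested by one of `k` users with probability
`q = 1 - (1 - 1 / N) ^ k`, independently of the file (`sum_uniformRequests_mem_image`). Hence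
`c d = N ^ (-K) / q` is an admissible choice of weights, and it turns the inequality into
`q (N - k M) ≤ ∑ d, N ^ (-K) * R d`. The worst case follows since a maximum dominates an average.

The minima are attained because the rate vectors compatible with `M` form a closed set of nonnegative
vectors, which contains the constant vector `N`, and both objectives are continuous and coercive on
it (`isLeast_image_fiber_optimalRegion`).
-/

/-! ### Shearer's inequality for finite sets -/

open Finset in
/-- Hölder's inequality for finitely many functions on a finite set. -/
theorem Real.sum_prod_rpow_le_prod_sum_rpow {ι α : Type*} (s : Finset ι) (t : Finset α)
    (w : ι → ℝ) (f : ι → α → ℝ) (hw : ∀ i ∈ s, 0 ≤ w i) (hw1 : ∑ i ∈ s, w i = 1)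
    (hf : ∀ i a, 0 ≤ f i a) :
    ∑ a ∈ t, ∏ i ∈ s, f i a ^ w i ≤ ∏ i ∈ s, (∑ a ∈ t, f i a) ^ w i := by
  have hT : ∀ i, 0 ≤ ∑ a ∈ t, f i a := fun i => sum_nonneg fun a _ => hf i a
  -- Normalise each `f i` by its sum; this is also correct, with junk division, when the sum is `0`.
  have hnorm : ∀ i, ∀ a ∈ t,
      f i a ^ w i = (∑ b ∈ t, f i b) ^ w i * (f i a / ∑ b ∈ t, f i b) ^ w i := by
    intro i a ha
    rw [← Real.mul_rpow (hT i) (div_nonneg (hf i a) (hT i))]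
    rcases (hT i).eq_or_lt with h | h
    · have h0 := (sum_eq_zero_iff_of_nonneg fun b _ => hf i b).1 h.symm a ha
      rw [← h, h0, zero_mul]
    · rw [mul_div_cancel₀ _ h.ne']
  have hle : ∑ a ∈ t, ∏ i ∈ s, (f i a / ∑ b ∈ t, f i b) ^ w i ≤ 1 :=
    calc
      _ ≤ ∑ a ∈ t, ∑ i ∈ s, w i * (f i a / ∑ b ∈ t, f i b) :=
        sum_le_sum fun a _ => Real.geom_mean_le_arith_mean_weighted s w _ hw hw1
          fun i _ => div_nonneg (hf i a) (hT i)
      _ = ∑ i ∈ s, w i * ((∑ a ∈ t, f i a) / ∑ b ∈ t, f i b) := by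
        rw [sum_comm]
        simp_rw [sum_div, mul_sum]
      _ ≤ ∑ i ∈ s, w i :=
        sum_le_sum fun i hi => mul_le_of_le_one_right (hw i hi) (div_self_le_one _)
      _ = 1 := hw1
  calc
    _ = ∑ a ∈ t, (∏ i ∈ s, (∑ b ∈ t, f i b) ^ w i) *
          ∏ i ∈ s, (f i a / ∑ b ∈ t, f i b) ^ w i :=
      sum_congr rfl fun a ha => by
        rw [← prod_mul_distrib]
        exact prod_congr rfl fun i _ => hnorm i a ha
    _ ≤ _ := by
      rw [← mul_sum]
      exact mul_le_of_le_one_right (prod_nonneg fun i _ => Real.rpow_nonneg (hT i) _) hle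

open Finset in
/-- The inductive step of Shearer's inequality: Hölder's inequality is applied to the factors in
`s`, whose weights sum to `1`, and the remaining factors are bounded pointwise. -/
theorem Real.sum_prod_rpow_le_prod_rpow {ι α : Type*} [Fintype ι]
    (s : Finset ι) (t : Finset α) (w : ι → ℝ) (f : ι → α → ℝ) (g : ι → ℝ)
    (hw : ∀ i, 0 ≤ w i) (hw1 : ∑ i ∈ s, w i = 1) (hf : ∀ i a, 0 ≤ f i a)
    (hsum : ∀ i ∈ s, ∑ a ∈ t, f i a ≤ g i) (hle : ∀ i a, f i a ≤ g i)
    (hg : ∀ i, 0 ≤ g i) :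
    ∑ a ∈ t, ∏ i, f i a ^ w i ≤ ∏ i, g i ^ w i := by
  classical
  calc
    _ ≤ ∑ a ∈ t, (∏ i ∈ s, f i a ^ w i) * ∏ i ∈ sᶜ, g i ^ w i := by
      refine sum_le_sum fun a _ => ?_
      rw [← prod_mul_prod_compl s]
      gcongr with i _ i _
      · exact prod_nonneg fun i _ => Real.rpow_nonneg (hf i a) _
      · exact fun i _ => Real.rpow_nonneg (hf i a) _
      · exact hf i a
      · exact hw i
      · exact hle i a
    _ = (∑ a ∈ t, ∏ i ∈ s, f i a ^ w i) * ∏ i ∈ sᶜ, g i ^ w i := by rw [sum_mul]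
    _ ≤ (∏ i ∈ s, (∑ a ∈ t, f i a) ^ w i) * ∏ i ∈ sᶜ, g i ^ w i := by
      gcongr
      · exact prod_nonneg fun i _ => Real.rpow_nonneg (hg i) _
      · exact Real.sum_prod_rpow_le_prod_sum_rpow s t w f (fun i _ => hw i) hw1 hf
    _ ≤ (∏ i ∈ s, g i ^ w i) * ∏ i ∈ sᶜ, g i ^ w i := by
      gcongr with i hi
      · exact prod_nonneg fun i _ => Real.rpow_nonneg (hg i) _
      · exact fun i _ => Real.rpow_nonneg (sum_nonneg fun a _ => hf i a) _
      · exact sum_nonneg fun a _ => hf i a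
      · exact hw i
      · exact hsum i hi
    _ = ∏ i, g i ^ w i := prod_mul_prod_compl s _

open Finset in
/-- Weighted combinatorial form of Shearer's inequality: if the sets `S d` with weights `w d` cover
every coordinate with total weight `1`, then the cardinality of a set of functions is at most the
weighted geometric mean of the cardinalities of its restrictions to the sets `S d`. -/
theorem Finset.card_le_prod_card_image_restrict {ι β δ : Type*} [Fintype ι] [DecidableEq ι]
    [DecidableEq β] [Fintype δ] (S : δ → Finset ι) (w : δ → ℝ) (hw : ∀ d, 0 ≤ w d)
    (hcover : ∀ i, ∑ d with i ∈ S d, w d = 1) (A : Finset (ι → β)) :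
    (#A : ℝ) ≤ ∏ d, (#(A.image (S d).restrict) : ℝ) ^ w d := by
  -- Induct on a set `T` of coordinates outside of which all members of `A` agree.
  suffices H : ∀ (T : Finset ι) (A : Finset (ι → β)),
      (∀ x ∈ A, ∀ y ∈ A, ∀ i ∉ T, x i = y i) →
      (#A : ℝ) ≤ ∏ d, (#(A.image (S d).restrict) : ℝ) ^ w d from
    H univ A fun _ _ _ _ i hi => absurd (mem_univ i) hi
  intro T
  induction T using Finset.induction_on with
  | empty =>
    intro A hA
    rcases A.eq_empty_or_nonempty with rfl | hne
    · simp only [card_empty, Nat.cast_zero]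
      positivity
    · have h1 : #A ≤ 1 := card_le_one.2 fun x hx y hy =>
        funext fun i => hA x hx y hy i (notMem_empty i)
      calc (#A : ℝ) ≤ 1 := by exact_mod_cast h1
        _ ≤ _ := by
          refine Finset.one_le_prod fun d _ => Real.one_le_rpow ?_ (hw d)
          exact Nat.one_le_cast.2 (hne.image _).card_pos
  | insert i T hi ih =>
    intro A hA
    set V := A.image fun x => x i
    set B : β → Finset (ι → β) := fun a => A.filter fun x => x i = a
    have hslice : ∀ a, (#(B a) : ℝ) ≤ ∏ d, (#((B a).image (S d).restrict) : ℝ) ^ w d := by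
      intro a
      refine ih (B a) fun x hx y hy j hj => ?_
      obtain ⟨hxA, hxa⟩ := mem_filter.1 hx
      obtain ⟨hyA, hya⟩ := mem_filter.1 hy
      by_cases hji : j = i
      · rw [hji, hxa, hya]
      · exact hA x hxA y hyA j (by simp [hji, hj])
    have hsub : ∀ d a, (B a).image (S d).restrict ⊆ A.image (S d).restrict :=
      fun d a => image_subset_image (filter_subset (fun x : ι → β => x i = a) A)
    -- If `i ∈ S d`, different slices have disjoint restrictions to `S d`.
    have hin : ∀ d, i ∈ S d →
        ∑ a ∈ V, (#((B a).image (S d).restrict) : ℝ) ≤ #(A.image (S d).restrict) := by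
      intro d hd
      rw [← Nat.cast_sum, Nat.cast_le, ← card_biUnion]
      · exact card_le_card (biUnion_subset.2 fun a _ => hsub d a)
      · intro a _ b _ hab
        simp only [Function.onFun, disjoint_left, mem_image, not_exists, not_and]
        rintro _ ⟨x, hx, rfl⟩ y hy hyx
        refine hab ?_
        rw [← (mem_filter.1 hx).2, ← (mem_filter.1 hy).2]
        exact (congrFun hyx ⟨i, hd⟩).symm
    have hout : ∀ d a, (#((B a).image (S d).restrict) : ℝ) ≤ #(A.image (S d).restrict) :=
      fun d a => Nat.cast_le.2 (card_le_card (hsub d a))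
    calc
      (#A : ℝ) = ∑ a ∈ V, (#(B a) : ℝ) := by
        rw [card_eq_sum_card_image (fun x : ι → β => x i) A, Nat.cast_sum]
      _ ≤ ∑ a ∈ V, ∏ d, (#((B a).image (S d).restrict) : ℝ) ^ w d :=
        sum_le_sum fun a _ => hslice a
      _ ≤ _ := Real.sum_prod_rpow_le_prod_rpow {d | i ∈ S d} V w
        (fun d a => (#((B a).image (S d).restrict) : ℝ)) _ hw (hcover i)
        (fun _ _ => Nat.cast_nonneg _) (fun d hd => hin d (mem_filter.1 hd).2) hout
        fun _ => Nat.cast_nonneg _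

/-! ### Uniform requests -/

namespace CodedCaching

theorem uniformRequests_apply {N K : ℕ} (d : Request N K) :
    uniformRequests N K d = (1 / (N : ℝ)) ^ K := by
  simp [uniformRequests, iidRequests]

theorem sum_uniformRequests (N K : ℕ) (hN : 1 ≤ N) :
    ∑ d : Request N K, uniformRequests N K d = 1 := by
  have hN0 : (N : ℝ) ≠ 0 := by positivity
  simp only [uniformRequests, iidRequests]
  rw [← Fintype.prod_sum fun (_ : Fin K) (_ : Fin N) => 1 / (N : ℝ)]
  simp [hN0]

/-- Under uniform requests, the probability that some user in `U` requests the file `j`. -/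
theorem sum_uniformRequests_mem_image (N K : ℕ) (hN : 1 ≤ N) (U : Finset (Fin K)) (j : Fin N) :
    ∑ d : Request N K with j ∈ U.image d, uniformRequests N K d
      = 1 - (1 - 1 / (N : ℝ)) ^ U.card := by
  have hN0 : (N : ℝ) ≠ 0 := by positivity
  have htot := sum_uniformRequests N K hN
  have hmiss : ∑ d : Request N K with j ∉ U.image d, uniformRequests N K d
      = (1 - 1 / (N : ℝ)) ^ U.card := by
    -- The event that no user in `U` requests `j` is a product event, with one factor per user.
    let g : Fin K → Fin N → ℝ := fun u n => if u ∈ U ∧ n = j then 0 else 1 / (N : ℝ)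
    have hg : ∀ d : Request N K,
        (if j ∉ U.image d then uniformRequests N K d else 0) = ∏ u, g u (d u) := by
      intro d
      by_cases h : j ∈ U.image d
      · obtain ⟨u, hu⟩ := Finset.mem_image.1 h
        rw [if_neg (not_not.2 h)]
        exact (Finset.prod_eq_zero (f := fun u => g u (d u)) (Finset.mem_univ u) (if_pos hu)).symm
      · rw [if_pos h]
        change ∏ _ : Fin K, 1 / (N : ℝ) = _
        refine Finset.prod_congr rfl fun u _ => ?_
        have : ¬ (u ∈ U ∧ d u = j) := fun hu => h (Finset.mem_image.2 ⟨u, hu⟩)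
        simp [g, this]
    have hsum : ∀ u, ∑ n, g u n = if u ∈ U then 1 - 1 / (N : ℝ) else 1 := by
      intro u
      split_ifs with h
      · have : ∀ n, g u n = 1 / (N : ℝ) - if n = j then 1 / (N : ℝ) else 0 := by
          intro n
          by_cases hn : n = j <;> simp [g, h, hn]
        simp_rw [this, Finset.sum_sub_distrib]
        simp [hN0]
      · simp [g, h, hN0]
    rw [Finset.sum_filter, Finset.sum_congr rfl fun d _ => hg d, ← Fintype.prod_sum]
    simp_rw [hsum]
    simp
  rw [← Finset.sum_filter_add_sum_filter_not Finset.univ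
    (fun d : Request N K => j ∈ U.image d), hmiss] at htot
  linarith

/-! ### Counting the databases served by one scheme -/

namespace Scheme

variable {N K F : ℕ} {M : ℝ} {R : Request N K → ℝ}

/-- The databases for which every user decodes correctly under every request vector. -/
noncomputable def goodDatabases (S : Scheme N K F M R) : Finset (Database N F) :=
  {w | ∀ d k, S.estimate w d k = w (d k)}

theorem userError_le_errorProb (S : Scheme N K F M R) (d : Request N K) (k : Fin K) :
    S.userError d k ≤ S.errorProb :=
  (le_ciSup (Set.finite_range _).bddAbove k).trans
    (le_ciSup (f := fun d => ⨆ k, S.userError d k) (Set.finite_range _).bddAbove d)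

/-- A union bound over all requests and users: most databases are good. -/
theorem card_goodDatabases_ge (S : Scheme N K F M R) :
    (1 - (Fintype.card (Request N K × Fin K) : ℝ) * S.errorProb) * (2 : ℝ) ^ (N * F) ≤
      (S.goodDatabases.card : ℝ) := by
  classical
  have hcard : (Fintype.card (Database N F) : ℝ) = 2 ^ (N * F) := by
    simp [Database, ← pow_mul, mul_comm]
  have hbad : (((S.goodDatabases)ᶜ).card : ℝ) ≤
      Fintype.card (Request N K × Fin K) * S.errorProb * 2 ^ (N * F) := by
    have hsub : (S.goodDatabases)ᶜ ⊆ (Finset.univ : Finset (Request N K × Fin K)).biUnion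
        fun p => Finset.univ.filter fun w : Database N F =>
          S.estimate w p.1 p.2 ≠ w (p.1 p.2) := by
      intro w hw
      simpa [goodDatabases] using hw
    calc (((S.goodDatabases)ᶜ).card : ℝ)
        ≤ ∑ p : Request N K × Fin K, ((Finset.univ.filter fun w : Database N F =>
          S.estimate w p.1 p.2 ≠ w (p.1 p.2)).card : ℝ) := by
          exact_mod_cast (Finset.card_le_card hsub).trans Finset.card_biUnion_le
      _ ≤ ∑ _p : Request N K × Fin K, S.errorProb * 2 ^ (N * F) := by
          refine Finset.sum_le_sum fun p _ => ?_
          have := S.userError_le_errorProb p.1 p.2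
          rwa [userError, hcard, div_le_iff₀ (by positivity)] at this
      _ = _ := by rw [Finset.sum_const, nsmul_eq_mul, Finset.card_univ, mul_assoc]
  have hsplit : (S.goodDatabases.card : ℝ) + ((S.goodDatabases)ᶜ).card = 2 ^ (N * F) := by
    rw [← hcard]
    exact_mod_cast Finset.card_add_card_compl S.goodDatabases
  linarith

/-- A set of good databases with the same contents `z` in the caches of the users in `U` is small.
For each `d`, the update determines the files that `U` requests, which bounds one projection of the
set; Shearer's inequality combines these bounds. -/
theorem card_le_of_cache_eq (S : Scheme N K F M R) (hR : ∀ d, 0 ≤ R d) (U : Finset (Fin K))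
    (c : Request N K → ℝ) (hc : ∀ d, 0 ≤ c d)
    (hcover : ∀ j, ∑ d with j ∈ U.image d, c d = 1) (A : Finset (Database N F))
    (hA : A ⊆ S.goodDatabases) (z : U → Fin (2 ^ ⌊(F : ℝ) * M⌋₊))
    (hz : ∀ w ∈ A, ∀ k : U, S.cache w k = z k) :
    (A.card : ℝ) ≤ 2 ^ ((F : ℝ) * ∑ d, c d * R d) := by
  have hproj : ∀ d : Request N K,
      ((A.image (U.image d).restrict).card : ℝ) ≤ (2 : ℝ) ^ ((F : ℝ) * R d) := by
    intro d
    have huser : ∀ j : U.image d, ∃ k : U, d k = j := fun j => by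
      obtain ⟨k, hk, hkj⟩ := Finset.mem_image.1 j.2
      exact ⟨⟨k, hk⟩, hkj⟩
    choose user huser using huser
    have hsub : A.image (U.image d).restrict ⊆
        Finset.univ.image fun x j => S.decode (user j) (z (user j)) d x := by
      intro y hy
      obtain ⟨w, hw, rfl⟩ := Finset.mem_image.1 hy
      refine Finset.mem_image.2 ⟨S.update w d, Finset.mem_univ _, funext fun j => ?_⟩
      have hgood := (Finset.mem_filter.1 (hA hw)).2 d (user j)
      rw [estimate, hz w hw, huser] at hgood
      exact hgood
    have hcard : (A.image (U.image d).restrict).card ≤ 2 ^ ⌊(F : ℝ) * R d⌋₊ := by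
      simpa using (Finset.card_le_card hsub).trans Finset.card_image_le
    calc ((A.image (U.image d).restrict).card : ℝ)
        ≤ (2 : ℝ) ^ (⌊(F : ℝ) * R d⌋₊ : ℝ) := by
          rw [Real.rpow_natCast]
          exact_mod_cast hcard
      _ ≤ (2 : ℝ) ^ ((F : ℝ) * R d) :=
          Real.rpow_le_rpow_of_exponent_le one_le_two
            (Nat.floor_le (mul_nonneg (Nat.cast_nonneg F) (hR d)))
  calc (A.card : ℝ)
      ≤ ∏ d, ((A.image (U.image d).restrict).card : ℝ) ^ c d :=
        Finset.card_le_prod_card_image_restrict (fun d : Request N K => U.image d) c hc hcover A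
    _ ≤ ∏ d, ((2 : ℝ) ^ ((F : ℝ) * R d)) ^ c d :=
        Finset.prod_le_prod (fun d _ => by positivity) fun d _ =>
          Real.rpow_le_rpow (Nat.cast_nonneg _) (hproj d) (hc d)
    _ = 2 ^ ((F : ℝ) * ∑ d, c d * R d) := by
        simp_rw [← Real.rpow_mul zero_le_two]
        rw [← Real.rpow_sum_of_pos zero_lt_two, Finset.mul_sum]
        exact congrArg _ (Finset.sum_congr rfl fun d _ => by ring)

/-- Summing `card_le_of_cache_eq` over all contents of the caches of the users in `U`. -/
theorem card_goodDatabases_le (S : Scheme N K F M R) (hM : 0 ≤ M) (hR : ∀ d, 0 ≤ R d)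
    (U : Finset (Fin K)) (c : Request N K → ℝ) (hc : ∀ d, 0 ≤ c d)
    (hcover : ∀ j, ∑ d with j ∈ U.image d, c d = 1) :
    (S.goodDatabases.card : ℝ) ≤ 2 ^ ((F : ℝ) * (U.card * M + ∑ d, c d * R d)) := by
  classical
  let caches : Database N F → U → Fin (2 ^ ⌊(F : ℝ) * M⌋₊) := fun w k => S.cache w k
  calc (S.goodDatabases.card : ℝ)
      = ∑ z : U → Fin (2 ^ ⌊(F : ℝ) * M⌋₊),
          ((S.goodDatabases.filter fun w => caches w = z).card : ℝ) := by
        rw [Finset.card_eq_sum_card_fiberwise (f := caches) (t := Finset.univ)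
          fun _ _ => Finset.mem_coe.2 (Finset.mem_univ _), Nat.cast_sum]
    _ ≤ ∑ _z : U → Fin (2 ^ ⌊(F : ℝ) * M⌋₊), (2 : ℝ) ^ ((F : ℝ) * ∑ d, c d * R d) :=
        Finset.sum_le_sum fun z _ => S.card_le_of_cache_eq hR U c hc hcover _
          (Finset.filter_subset _ _) z fun w hw k => congrFun (Finset.mem_filter.1 hw).2 k
    _ = (2 : ℝ) ^ ((⌊(F : ℝ) * M⌋₊ : ℝ) * U.card) * 2 ^ ((F : ℝ) * ∑ d, c d * R d) := by
        rw [Finset.sum_const, nsmul_eq_mul, ← Nat.cast_mul, Real.rpow_natCast, pow_mul]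
        simp
    _ ≤ (2 : ℝ) ^ ((F : ℝ) * M * U.card) * 2 ^ ((F : ℝ) * ∑ d, c d * R d) := by
        gcongr
        · exact one_le_two
        · exact Nat.floor_le (mul_nonneg (Nat.cast_nonneg F) hM)
    _ = _ := by
        rw [← Real.rpow_add zero_lt_two]
        congr 1
        ring

end Scheme

/-! ### The rate region -/

/-- The converse inequality for a set `U` of users and any weights `c` on the requests under which
every file is requested by `U` with total weight `1`. -/
theorem le_of_mem_achievable {N K : ℕ} {p : ℝ × (Request N K → ℝ)} (hp : p ∈ achievable N K)
    (U : Finset (Fin K)) (c : Request N K → ℝ) (hc : ∀ d, 0 ≤ c d)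
    (hcover : ∀ j, ∑ d with j ∈ U.image d, c d = 1) :
    (N : ℝ) ≤ U.card * p.1 + ∑ d, c d * p.2 d := by
  obtain ⟨hM, hR, hS⟩ := hp
  by_contra! hlt
  -- If the inequality fails by `N - L > 0`, a file size `F` allows only a fraction
  -- `2 ^ (F (L - N)) ≤ 2 ^ (L - N) < 1` of good databases, whatever `F ≥ 1` is.
  set L := U.card * p.1 + ∑ d, c d * p.2 d
  set C : ℝ := (Fintype.card (Request N K × Fin K) : ℝ)
  have hC0 : 0 ≤ C := Nat.cast_nonneg _
  have hgap : (2 : ℝ) ^ (L - N) < 1 := Real.rpow_lt_one_of_one_lt_of_neg one_lt_two (by linarith)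
  obtain ⟨F, hF, S, hSε⟩ := hS ((1 - (2 : ℝ) ^ (L - N)) / (C + 1))
    (div_pos (by linarith) (by linarith))
  rw [lt_div_iff₀ (by linarith)] at hSε
  have hCε : C * S.errorProb < 1 - (2 : ℝ) ^ (L - N) := by
    rcases le_or_gt 0 S.errorProb with h | h
    · linarith
    · exact (mul_nonpos_of_nonneg_of_nonpos hC0 h.le).trans_lt (by linarith)
  have hF1 : (1 : ℝ) ≤ F := by exact_mod_cast hF
  have hmain := S.card_goodDatabases_ge.trans (S.card_goodDatabases_le hM hR U c hc hcover)
  have h1 : (2 : ℝ) ^ ((F : ℝ) * L) ≤ (2 : ℝ) ^ (L - N) * 2 ^ (N * F) := by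
    rw [← Real.rpow_natCast, ← Real.rpow_add zero_lt_two]
    refine Real.rpow_le_rpow_of_exponent_le one_le_two ?_
    push_cast
    nlinarith
  have h2 := hmain.trans h1
  have h3 := le_of_mul_le_mul_right h2 (by positivity)
  linarith

theorem isClosed_optimalRegion (N K : ℕ) : IsClosed (optimalRegion N K) := isClosed_closure

theorem nonneg_of_mem_optimalRegion {N K : ℕ} {p : ℝ × (Request N K → ℝ)}
    (hp : p ∈ optimalRegion N K) (d : Request N K) : 0 ≤ p.2 d :=
  closure_minimal (t := {p : ℝ × (Request N K → ℝ) | 0 ≤ p.2 d}) (fun _ h => h.2.1 d)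
    (isClosed_le continuous_const (by fun_prop)) hp

theorem le_of_mem_optimalRegion {N K : ℕ} {p : ℝ × (Request N K → ℝ)}
    (hp : p ∈ optimalRegion N K) (U : Finset (Fin K)) (c : Request N K → ℝ) (hc : ∀ d, 0 ≤ c d)
    (hcover : ∀ j, ∑ d with j ∈ U.image d, c d = 1) :
    (N : ℝ) ≤ U.card * p.1 + ∑ d, c d * p.2 d :=
  closure_minimal (t := {p : ℝ × (Request N K → ℝ) | (N : ℝ) ≤ U.card * p.1 + ∑ d, c d * p.2 d})
    (fun _ h => le_of_mem_achievable h U c hc hcover)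
    (isClosed_le continuous_const (by fun_prop)) hp

/-! ### Existence of the minima and the bound -/

/-- At rate `N`, the update can be the whole database, so the cache is not needed. -/
theorem const_mem_achievable (N K : ℕ) {M : ℝ} (hM : 0 ≤ M) :
    (M, fun _ => (N : ℝ)) ∈ achievable N K := by
  refine ⟨hM, fun _ => Nat.cast_nonneg N, fun ε hε => ⟨1, one_pos, ?_⟩⟩
  have hcard : Fintype.card (Database N 1) = 2 ^ ⌊((1 : ℕ) : ℝ) * (N : ℝ)⌋₊ := by simp
  let e := Fintype.equivFinOfCardEq hcard
  let S : Scheme N K 1 M fun _ => (N : ℝ) :=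
    { cache := fun _ _ => 0
      update := fun w _ => e w
      decode := fun k _ d x => e.symm x (d k) }
  have hS : ∀ d k, S.userError d k = 0 := by
    intro d k
    simp [Scheme.userError, Scheme.estimate, S]
  refine ⟨S, ?_⟩
  simpa [Scheme.errorProb, hS] using hε

/-- A continuous objective that is coercive on nonnegative rate vectors attains its minimum over the
rate vectors compatible with the memory `M`. -/
theorem isLeast_image_fiber_optimalRegion {N K : ℕ} {M : ℝ} (hM : 0 ≤ M)
    (f : (Request N K → ℝ) → ℝ) (hf : Continuous f) {c : ℝ} (hc : 0 < c)
    (hcoer : ∀ R, (∀ d, 0 ≤ R d) → ∀ d, c * R d ≤ f R) :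
    IsLeast {r | ∃ R, (M, R) ∈ optimalRegion N K ∧ r = f R}
      (sInf {r | ∃ R, (M, R) ∈ optimalRegion N K ∧ r = f R}) := by
  set R₀ : Request N K → ℝ := fun _ => N
  have hR₀ : (M, R₀) ∈ optimalRegion N K := subset_closure (const_mem_achievable N K hM)
  set D : Set (Request N K → ℝ) := {R | (M, R) ∈ optimalRegion N K}
  have hD : IsClosed D := (isClosed_optimalRegion N K).preimage (by fun_prop)
  have hcpt : IsCompact (D ∩ {R | f R ≤ f R₀}) := by
    refine (isCompact_univ_pi fun _ => isCompact_Icc (a := (0 : ℝ)) (b := f R₀ / c)).of_isClosed_subset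
      (hD.inter (isClosed_le hf continuous_const)) fun R hR d _ => ?_
    have h0 := nonneg_of_mem_optimalRegion hR.1
    refine ⟨h0 d, ?_⟩
    rw [le_div_iff₀ hc, mul_comm]
    exact (hcoer R h0 d).trans hR.2
  obtain ⟨R, hR, hmin⟩ := hcpt.exists_isMinOn ⟨R₀, hR₀, le_refl (f R₀)⟩ hf.continuousOn
  have hleast : IsLeast {r | ∃ R, (M, R) ∈ optimalRegion N K ∧ r = f R} (f R) := by
    refine ⟨⟨R, hR.1, rfl⟩, ?_⟩
    rintro _ ⟨R', hR', rfl⟩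
    rcases le_or_gt (f R') (f R₀) with h | h
    · exact hmin ⟨hR', h⟩
    · exact hR.2.trans h.le
  rwa [hleast.csInf_eq]

/-- Every rate vector compatible with `M` has average rate at least the converse bound. The weights
in `le_of_mem_optimalRegion` are the request probabilities divided by the probability that a given
file is requested by one of `k` users. -/
theorem converseBound_le_sum {N K : ℕ} (hN : 1 ≤ N) (hK : 1 ≤ K) {M : ℝ}
    {R : Request N K → ℝ} (hR : (M, R) ∈ optimalRegion N K) :
    converseBound N K hK M ≤ ∑ d, uniformRequests N K d * R d := by
  refine Finset.sup'_le _ _ fun k hk => ?_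
  obtain ⟨hk1, hkK⟩ := Finset.mem_Icc.1 hk
  have hp : ∀ d, 0 ≤ uniformRequests N K d := fun d => by
    rw [uniformRequests_apply]
    positivity
  have hsum0 : 0 ≤ ∑ d, uniformRequests N K d * R d :=
    Finset.sum_nonneg fun d _ => mul_nonneg (hp d) (nonneg_of_mem_optimalRegion hR d)
  have hNinv : 0 < 1 / (N : ℝ) := one_div_pos.2 (by exact_mod_cast hN)
  have hNinv1 : 1 / (N : ℝ) ≤ 1 := (div_le_one₀ (by exact_mod_cast hN)).2 (by exact_mod_cast hN)
  have hq : 0 < 1 - (1 - 1 / (N : ℝ)) ^ k :=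
    sub_pos.2 (pow_lt_one₀ (by linarith) (by linarith) (by omega))
  obtain ⟨U, -, hU⟩ := Finset.exists_subset_card_eq (s := (Finset.univ : Finset (Fin K)))
    (n := k) (by simpa using hkK)
  have h := le_of_mem_optimalRegion hR U
    (fun d => uniformRequests N K d / (1 - (1 - 1 / (N : ℝ)) ^ k))
    (fun d => div_nonneg (hp d) hq.le)
    (fun j => by
      rw [← Finset.sum_div, sum_uniformRequests_mem_image N K hN, hU, div_self hq.ne'])
  rw [hU] at h
  rcases max_cases ((N : ℝ) - k * M) 0 with ⟨hm, -⟩ | ⟨hm, -⟩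
  · rw [hm, ← le_div_iff₀' hq, Finset.sum_div]
    simp_rw [div_mul_eq_mul_div] at h
    linarith
  · rwa [hm, mul_zero]

end CodedCaching

theorem corollary1 (N K : ℕ) (hN : 1 ≤ N) (hK : 1 ≤ K) (M : ℝ) (hM : 0 ≤ M) :
    -- the minima that define the two optimal rates are attained
    IsLeast (CodedCaching.avgRates N K (CodedCaching.uniformRequests N K) M)
        (CodedCaching.uniformRate N K M) ∧
      IsLeast (CodedCaching.worstRates N K M) (CodedCaching.worstRate N K M) ∧
      -- the bound, for the uniform case and for the worst case
      CodedCaching.converseBound N K hK M ≤ CodedCaching.uniformRate N K M ∧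
      CodedCaching.converseBound N K hK M ≤ CodedCaching.worstRate N K M := by
  have hN0 : 0 < (1 / (N : ℝ)) ^ K := by positivity
  have : Nonempty (Fin N) := ⟨⟨0, hN⟩⟩
  have hbdd : ∀ R : CodedCaching.Request N K → ℝ, BddAbove (Set.range R) :=
    fun R => (Set.finite_range R).bddAbove
  have havg := CodedCaching.isLeast_image_fiber_optimalRegion (N := N) (K := K) hM
    (fun R => ∑ d, CodedCaching.uniformRequests N K d * R d) (by fun_prop) hN0
    fun R hR d => by
      simp_rw [CodedCaching.uniformRequests_apply]
      exact Finset.single_le_sum (f := fun d => (1 / (N : ℝ)) ^ K * R d)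
        (fun d _ => mul_nonneg hN0.le (hR d)) (Finset.mem_univ d)
  have hworst := CodedCaching.isLeast_image_fiber_optimalRegion (N := N) (K := K) hM
    (fun R => ⨆ d, R d)
    (by
      simp_rw [← Finset.sup'_univ_eq_ciSup]
      exact Continuous.finset_sup'_apply _ fun d _ => continuous_apply d)
    one_pos fun R _ d => by
      rw [one_mul]
      exact le_ciSup (hbdd R) d
  refine ⟨havg, hworst, ?_, ?_⟩
  · obtain ⟨R, hR, h⟩ := havg.1
    exact (CodedCaching.converseBound_le_sum hN hK hR).trans_eq h.symm
  · obtain ⟨R, hR, h⟩ := hworst.1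
    refine (CodedCaching.converseBound_le_sum hN hK hR).trans (le_of_le_of_eq ?_ h.symm)
    -- The average of `R` is at most its maximum.
    calc ∑ d, CodedCaching.uniformRequests N K d * R d
        ≤ ∑ d, CodedCaching.uniformRequests N K d * ⨆ d, R d := by
          refine Finset.sum_le_sum fun d _ => mul_le_mul_of_nonneg_left (le_ciSup (hbdd R) d) ?_
          rw [CodedCaching.uniformRequests_apply]
          exact hN0.le
      _ = ⨆ d, R d := by
          rw [← Finset.sum_mul, CodedCaching.sum_uniformRequests N K hN, one_mul]
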